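/- Let $\sigma>0$ be a real number, let $q=\exp\left(-\frac{1}{4\sigma^2}\right)\in(0,1)$, and let $\vartheta_3(t,q)=\sum_{k=-\infty}^{\infty}q^{k^2}e^{2ikt}$ for $|q|<1$ denote the third Jacobi theta function. Then $\vartheta_3(t,q^2)\neq 0$ for all $t\in[0,\pi]$, and the function $$P(t)=\frac{\vartheta_3(t,q)}{\left[\vartheta_3(t,q^2)\right]^2},\qquad t\in[0,\pi],$$ is well defined and real-valued. It is strictly decreasing on the interval $\left(0,\frac{\pi}{2}\right)$ and strictly increasing on the interval $\left(\frac{\pi}{2},\pi\right)$. -/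

import Mathlib

/-- The third Jacobi theta function `ϑ₃(t, q) = ∑_{k ∈ ℤ} q^(k²) e^(2ikt)`, `|q| < 1`. -/
noncomputable def theta3 (t q : ℂ) : ℂ :=
  ∑' k : ℤ, q ^ (k ^ 2) * Complex.exp (2 * Complex.I * (k : ℂ) * t)

/-- The defining series of `ϑ₃` converges absolutely for every `|q| < 1`. -/
theorem hasSum_theta3 (t q : ℂ) (hq : ‖q‖ < 1) :
    HasSum (fun k : ℤ => q ^ (k ^ 2) * Complex.exp (2 * Complex.I * (k : ℂ) * t))
      (theta3 t q) := by
  refine Summable.hasSum ?_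
  by_cases h0 : q = 0
  · refine summable_of_ne_finset_zero (s := {0}) fun k hk => ?_
    have hk' : k ≠ 0 := by simpa using hk
    rw [h0, zero_zpow _ (pow_ne_zero 2 hk'), zero_mul]
  · have hpi : (Real.pi : ℂ) ≠ 0 := by exact_mod_cast Real.pi_ne_zero
    set τ : ℂ := Complex.log q / (Real.pi * Complex.I) with hτ
    have hτq : Real.pi * Complex.I * τ = Complex.log q := by
      rw [hτ]; field_simp
    have him : 0 < τ.im := by
      have h1 : (Real.pi * Complex.I * τ).re = -(Real.pi * τ.im) := by simp
      rw [hτq, Complex.log_re] at h1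
      have h2 : Real.log ‖q‖ < 0 := Real.log_neg (norm_pos_iff.mpr h0) hq
      nlinarith [Real.pi_pos]
    refine ((summable_jacobiTheta₂_term_iff (t / Real.pi) τ).mpr him).congr fun k => ?_
    have h3 : q ^ (k ^ 2) = Complex.exp ((k : ℂ) ^ 2 * Complex.log q) := by
      conv_lhs => rw [← Complex.exp_log h0, ← Complex.exp_int_mul]
      push_cast; rfl
    rw [jacobiTheta₂_term, h3, ← Complex.exp_add, ← hτq]
    congr 1
    field_simp
    ring

/-- The ratio `P(t) = ϑ₃(t, q) / ϑ₃(t, q²)²`. -/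
noncomputable def thetaRatio (q t : ℂ) : ℂ :=
  theta3 t q / theta3 t (q ^ 2) ^ 2

open Filter Topology Finset

/-!
Let `r = √q`, `A(t) = ϑ₃(t / 2, r)` and `B(t) = A(t + π)`. Splitting the series for `A` and `B`
by the parity of the index gives `A + B = 2 ϑ₃(t, q²)` (`theta3_half_add_shift`), and splitting the
double series for their squares gives `A² + B² = 2 ϑ₃(t, q) ϑ₃(0, q)` (`theta3_half_sq_add_sq`).
Hence, with the contrast `w = (A - B) / (A + B)`,
`P(t) = 2 (A² + B²) / (ϑ₃(0, q) (A + B)²) = (1 + w(t)²) / ϑ₃(0, q)` (`thetaRatio_eq`).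

It remains to see that `A` and `B` are positive and that `w` is strictly decreasing on `[0, π]`
with `w(π / 2) = 0`: then `w²` decreases up to `π / 2` and increases afterwards. All of this can be
read off from Jacobi's triple product `A(t) = d ∏ (1 + 2 r^(2k+1) cos t + r^(4k+2))` with `d > 0`
(`exists_theta3_product`). The product is positive, it depends only on `cos t`, and in `B / A` every
factor `(1 - 2 a cos t + a²) / (1 + 2 a cos t + a²)` is strictly increasing on `[0, π]`
(`thetaHalf_cross_lt`). The triple product is obtained from its finite form, where the
coefficients are Gaussian binomials (`hasSum_finite_triple_product`), by dominated convergence.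
-/

/-! ### Infinite products bounded away from zero -/

/-- Partial products `∏ (1 - a k)` over a summable sequence in `[0, 1)` have a positive limit. -/
theorem exists_pos_tendsto_prod_one_sub {a : ℕ → ℝ} (h1 : ∀ k, a k < 1) (hs : Summable a) :
    ∃ d > 0, Tendsto (fun n => ∏ k ∈ range n, (1 - a k)) atTop (𝓝 d) := by
  have hlog := Real.summable_log_one_add_of_summable hs.neg
  have hp := Real.hasProd_of_hasSum_log (fun i => by linarith [h1 i]) hlog.hasSum
  exact ⟨_, Real.exp_pos _, by simpa [sub_eq_add_neg] using hp.tendsto_prod_nat⟩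

theorem antitone_prod_one_sub {a : ℕ → ℝ} (h0 : ∀ k, 0 ≤ a k) (h1 : ∀ k, a k < 1) :
    Antitone (fun n => ∏ k ∈ range n, (1 - a k)) := by
  refine antitone_nat_of_succ_le fun n => ?_
  rw [prod_range_succ]
  refine mul_le_of_le_one_right (prod_nonneg fun k _ => ?_) ?_
  · linarith [h1 k]
  · linarith [h0 n]

/-! ### The finite triple product identity -/

/-- The `q`-Pochhammer symbol `(Q; Q)_n = ∏_{k=1}^n (1 - Q^k)`. -/
noncomputable def qPoch (Q : ℝ) (n : ℕ) : ℝ := ∏ k ∈ range n, (1 - Q ^ (k + 1))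

/-- The reciprocal of `(Q; Q)_m`, extended by zero to negative `m`. With this convention the
recurrence `invQPoch_sub_one` holds for every integer. -/
noncomputable def invQPoch (Q : ℝ) (m : ℤ) : ℝ := if m < 0 then 0 else (qPoch Q m.toNat)⁻¹

/-- The Gaussian binomial coefficient `[2n choose n + j]` in base `Q`, which is zero for
`|j| > n`. -/
noncomputable def centralQBinom (Q : ℝ) (n : ℕ) (j : ℤ) : ℝ :=
  qPoch Q (2 * n) * invQPoch Q (n + j) * invQPoch Q (n - j)

section qPoch

variable {Q : ℝ}

theorem one_sub_pow_pos (h0 : 0 < Q) (h1 : Q < 1) (n : ℕ) : 0 < 1 - Q ^ (n + 1) :=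
  sub_pos.mpr (pow_lt_one₀ h0.le h1 n.succ_ne_zero)

theorem qPoch_pos (h0 : 0 < Q) (h1 : Q < 1) (n : ℕ) : 0 < qPoch Q n :=
  prod_pos fun k _ => one_sub_pow_pos h0 h1 k

theorem qPoch_le_one (h0 : 0 < Q) (h1 : Q < 1) (n : ℕ) : qPoch Q n ≤ 1 :=
  prod_le_one (fun k _ => (one_sub_pow_pos h0 h1 k).le)
    fun k _ => by linarith [pow_pos h0 (k + 1)]

/-- The partial products `(Q; Q)_n` decrease to a positive limit `(Q; Q)_∞`. -/
theorem exists_qPoch_limit (h0 : 0 < Q) (h1 : Q < 1) :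
    ∃ d > 0, Tendsto (qPoch Q) atTop (𝓝 d) ∧ ∀ n, d ≤ qPoch Q n := by
  have hlt : ∀ k : ℕ, Q ^ (k + 1) < 1 := fun k => pow_lt_one₀ h0.le h1 k.succ_ne_zero
  obtain ⟨d, hd, ht⟩ := exists_pos_tendsto_prod_one_sub hlt
    ((summable_nat_add_iff 1).mpr (summable_geometric_of_lt_one h0.le h1))
  exact ⟨d, hd, ht, (antitone_prod_one_sub (fun k => (pow_pos h0 _).le) hlt).le_of_tendsto ht⟩

theorem invQPoch_sub_one (h0 : 0 < Q) (h1 : Q < 1) (m : ℤ) :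
    invQPoch Q (m - 1) = (1 - Q ^ m) * invQPoch Q m := by
  rcases lt_trichotomy m 0 with h | rfl | h
  · simp [invQPoch, h, show m - 1 < 0 by omega]
  · simp [invQPoch]
  · obtain ⟨n, rfl⟩ : ∃ n : ℕ, m = n + 1 := ⟨(m - 1).toNat, by omega⟩
    have e1 : ((n : ℤ) + 1).toNat = n + 1 := by omega
    have h2 := (one_sub_pow_pos h0 h1 n).ne'
    have h3 := (qPoch_pos h0 h1 n).ne'
    have e2 : Q ^ ((n : ℤ) + 1) = Q ^ (n + 1) := by exact_mod_cast zpow_natCast Q (n + 1)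
    have e3 : qPoch Q (n + 1) = qPoch Q n * (1 - Q ^ (n + 1)) := prod_range_succ _ _
    simp only [invQPoch, add_sub_cancel_right, Int.toNat_natCast, e1, e2, e3,
      show ¬ ((n : ℤ) < 0) by omega, show ¬ ((n : ℤ) + 1 < 0) by omega, if_false]
    field_simp

/-- The Pascal-type recurrence that makes the finite triple product identity an induction: it
compares the coefficients of `z ^ j` on multiplying by
`(1 + r ^ (2n+1) z) (1 + r ^ (2n+1) z⁻¹)`. -/
theorem centralQBinom_succ {r : ℝ} (h0 : 0 < r) (h1 : r < 1) (n : ℕ) (j : ℤ) :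
    centralQBinom (r ^ 2) (n + 1) j * r ^ (j ^ 2) =
      (1 + (r ^ (2 * n + 1)) ^ 2) * (centralQBinom (r ^ 2) n j * r ^ (j ^ 2)) +
      r ^ (2 * n + 1) * (centralQBinom (r ^ 2) n (j - 1) * r ^ ((j - 1) ^ 2) +
        centralQBinom (r ^ 2) n (j + 1) * r ^ ((j + 1) ^ 2)) := by
  have hQ0 : 0 < r ^ 2 := by positivity
  have hQ1 : r ^ 2 < 1 := pow_lt_one₀ h0.le h1 two_ne_zero
  have hr := h0.ne'
  have hrec := invQPoch_sub_one hQ0 hQ1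
  set x : ℝ := r ^ n with hx
  set y : ℝ := r ^ j with hy
  have hx0 : x ≠ 0 := pow_ne_zero _ hr
  have hy0 : y ≠ 0 := zpow_ne_zero _ hr
  have a1 : (r ^ 2) ^ ((n : ℤ) + 1 + j) = r ^ 2 * x ^ 2 * y ^ 2 := by
    rw [zpow_add₀ hQ0.ne', zpow_add₀ hQ0.ne', zpow_natCast, zpow_one, hx, hy, ← pow_mul,
      ← pow_mul, mul_comm n 2, ← zpow_natCast (r ^ j), ← zpow_mul, mul_comm j, zpow_mul]
    norm_cast; ring
  have a2 : (r ^ 2) ^ ((n : ℤ) + 1 - j) = r ^ 2 * x ^ 2 / y ^ 2 := by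
    rw [zpow_sub₀ hQ0.ne', zpow_add₀ hQ0.ne', zpow_natCast, zpow_one, hx, hy, ← pow_mul,
      ← pow_mul, mul_comm n 2, ← zpow_natCast (r ^ j), ← zpow_mul, mul_comm j, zpow_mul]
    norm_cast; ring
  have a3 : (r ^ 2) ^ ((n : ℤ) + j) = x ^ 2 * y ^ 2 := by
    rw [show (n : ℤ) + j = (n + 1 + j) - 1 by ring, zpow_sub_one₀ hQ0.ne', a1]
    field_simp
  have a4 : (r ^ 2) ^ ((n : ℤ) - j) = x ^ 2 / y ^ 2 := by
    rw [show (n : ℤ) - j = (n + 1 - j) - 1 by ring, zpow_sub_one₀ hQ0.ne', a2]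
    field_simp
  set u := invQPoch (r ^ 2) (n + 1 + j) with hu
  set v := invQPoch (r ^ 2) (n + 1 - j) with hv
  have b1 : invQPoch (r ^ 2) (n + j) = (1 - r ^ 2 * x ^ 2 * y ^ 2) * u := by
    rw [← a1, hu, ← hrec]; congr 1; ring
  have b2 : invQPoch (r ^ 2) (n - j) = (1 - r ^ 2 * x ^ 2 / y ^ 2) * v := by
    rw [← a2, hv, ← hrec]; congr 1; ring
  have b3 : invQPoch (r ^ 2) (n + (j - 1)) =
      (1 - x ^ 2 * y ^ 2) * ((1 - r ^ 2 * x ^ 2 * y ^ 2) * u) := by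
    rw [← b1, ← a3, ← hrec]; congr 1; ring
  have b4 : invQPoch (r ^ 2) (n - (j + 1)) =
      (1 - x ^ 2 / y ^ 2) * ((1 - r ^ 2 * x ^ 2 / y ^ 2) * v) := by
    rw [← b2, ← a4, ← hrec]; congr 1; ring
  have c1 : r ^ ((j - 1) ^ 2) = r ^ (j ^ 2) * r / y ^ 2 := by
    rw [show (j - 1) ^ 2 = j ^ 2 + 1 - (j + j) by ring, zpow_sub₀ hr, zpow_add₀ hr,
      zpow_add₀ hr, zpow_one, ← hy, sq y]
  have c2 : r ^ ((j + 1) ^ 2) = r ^ (j ^ 2) * r * y ^ 2 := by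
    rw [show (j + 1) ^ 2 = j ^ 2 + 1 + (j + j) by ring, zpow_add₀ hr, zpow_add₀ hr,
      zpow_add₀ hr, zpow_one, ← hy, sq y]
  have c3 : qPoch (r ^ 2) (2 * (n + 1)) =
      qPoch (r ^ 2) (2 * n) * (1 - r ^ 2 * x ^ 4) * (1 - r ^ 4 * x ^ 4) := by
    rw [show 2 * (n + 1) = 2 * n + 1 + 1 by ring, qPoch, prod_range_succ, prod_range_succ, hx]
    simp only [qPoch]
    ring
  have c4 : r ^ (2 * n + 1) = r * x ^ 2 := by rw [hx]; ring
  simp only [centralQBinom, Nat.cast_add, Nat.cast_one, ← hu, ← hv, b1, b2, b3, b4, c1, c2, c3, c4,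
    show (n : ℤ) - (j - 1) = n + 1 - j by ring, show (n : ℤ) + (j + 1) = n + 1 + j by ring]
  field_simp
  ring

end qPoch

/-- The finite form of Jacobi's triple product identity. -/
theorem hasSum_finite_triple_product {r : ℝ} (h0 : 0 < r) (h1 : r < 1) {z : ℂ} (hz : z ≠ 0)
    (n : ℕ) :
    HasSum (fun j : ℤ => ((centralQBinom (r ^ 2) n j * r ^ (j ^ 2) : ℝ) : ℂ) * z ^ j)
      (∏ k ∈ range n, (1 + (r : ℂ) ^ (2 * k + 1) * z) * (1 + (r : ℂ) ^ (2 * k + 1) * z⁻¹)) := by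
  induction n with
  | zero =>
    rw [prod_range_zero]
    convert hasSum_ite_eq (0 : ℤ) (1 : ℂ) using 2 with j
    rcases lt_trichotomy j 0 with h | rfl | h
    · simp [centralQBinom, invQPoch, h, h.ne]
    · simp [centralQBinom, invQPoch, qPoch]
    · simp [centralQBinom, invQPoch, h, h.ne']
  | succ n ih =>
    have hl := ((Equiv.subRight (1 : ℤ)).hasSum_iff.mpr ih).mul_right z
    have hr := ((Equiv.addRight (1 : ℤ)).hasSum_iff.mpr ih).mul_right z⁻¹
    have := (ih.mul_left (1 + ((r : ℂ) ^ (2 * n + 1)) ^ 2)).add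
      ((hl.add hr).mul_left ((r : ℂ) ^ (2 * n + 1)))
    rw [prod_range_succ, show ∀ p a : ℂ, p * ((1 + a * z) * (1 + a * z⁻¹)) =
      (1 + a ^ 2) * p + a * (p * z + p * z⁻¹) from fun p a => by field_simp; ring]
    refine this.congr_fun fun j => ?_
    rw [centralQBinom_succ h0 h1]
    simp only [Function.comp, Equiv.subRight_apply, Equiv.coe_addRight]
    rw [zpow_sub_one₀ hz, zpow_add_one₀ hz]
    push_cast
    field_simp

/-! ### The infinite triple product -/

theorem theta3_half_term (r : ℝ) (t : ℝ) (k : ℤ) :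
    (r : ℂ) ^ (k ^ 2) * Complex.exp (2 * Complex.I * (k : ℂ) * ((t / 2 : ℝ) : ℂ)) =
      ((r ^ (k ^ 2) : ℝ) : ℂ) * Complex.exp (t * Complex.I) ^ k := by
  rw [← Complex.exp_int_mul]
  push_cast
  congr 2
  ring

/-- The `k`-th factor of the product for `ϑ₃(t / 2, r)`, as a function of `c = cos t`. -/
noncomputable def thetaFactor (r c : ℝ) (k : ℕ) : ℝ :=
  1 + 2 * r ^ (2 * k + 1) * c + (r ^ (2 * k + 1)) ^ 2

theorem prod_thetaFactor_eq (r t : ℝ) (n : ℕ) :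
    ((∏ k ∈ range n, thetaFactor r (Real.cos t) k : ℝ) : ℂ) =
      ∏ k ∈ range n, (1 + (r : ℂ) ^ (2 * k + 1) * Complex.exp (t * Complex.I)) *
        (1 + (r : ℂ) ^ (2 * k + 1) * (Complex.exp (t * Complex.I))⁻¹) := by
  push_cast
  refine prod_congr rfl fun k _ => ?_
  have h2 : 2 * Complex.cos t = Complex.exp (t * Complex.I) + (Complex.exp (t * Complex.I))⁻¹ := by
    rw [Complex.two_cos, ← Complex.exp_neg, neg_mul]
  have h3 := mul_inv_cancel₀ (Complex.exp_ne_zero (t * Complex.I))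
  simp only [thetaFactor]
  push_cast
  linear_combination (r : ℂ) ^ (2 * k + 1) * h2 - ((r : ℂ) ^ (2 * k + 1)) ^ 2 * h3

/-- Jacobi's triple product: `ϑ₃(t / 2, r)` is a positive constant times the infinite product of
the `thetaFactor`s. It follows from the finite identity by dominated convergence. -/
theorem exists_theta3_product {r : ℝ} (h0 : 0 < r) (h1 : r < 1) :
    ∃ d > 0, ∀ t : ℝ, Tendsto
      (fun n => ((d * ∏ k ∈ range n, thetaFactor r (Real.cos t) k : ℝ) : ℂ)) atTop
      (𝓝 (theta3 ((t / 2 : ℝ) : ℂ) r)) := by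
  have hQ0 : 0 < r ^ 2 := by positivity
  have hQ1 : r ^ 2 < 1 := pow_lt_one₀ h0.le h1 two_ne_zero
  obtain ⟨d, hd, ht, hle⟩ := exists_qPoch_limit hQ0 hQ1
  refine ⟨d, hd, fun t => ?_⟩
  set z := Complex.exp (t * Complex.I) with hz
  have hz1 : ‖z‖ = 1 := Complex.norm_exp_ofReal_mul_I t
  have hth := hasSum_theta3 ((t / 2 : ℝ) : ℂ) (r : ℂ) (by
    rwa [Complex.norm_real, Real.norm_of_nonneg h0.le])
  simp only [theta3_half_term, ← hz] at hth
  have hip0 (m : ℤ) : 0 ≤ invQPoch (r ^ 2) m := by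
    unfold invQPoch
    split_ifs
    exacts [le_rfl, (inv_pos.mpr (qPoch_pos hQ0 hQ1 _)).le]
  have hip1 (m : ℤ) : invQPoch (r ^ 2) m ≤ d⁻¹ := by
    unfold invQPoch
    split_ifs
    exacts [(inv_pos.mpr hd).le, inv_anti₀ hd (hle _)]
  have hlim (f : ℕ → ℤ) (hf : Tendsto f atTop atTop) :
      Tendsto (fun n => invQPoch (r ^ 2) (f n)) atTop (𝓝 d⁻¹) := by
    have hN : Tendsto (fun n => (f n).toNat) atTop atTop :=
      tendsto_atTop.mpr fun b => (hf.eventually_ge_atTop (b : ℤ)).mono fun n hn => by omega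
    refine ((ht.comp hN).inv₀ hd.ne').congr' ?_
    filter_upwards [hf.eventually_ge_atTop 0] with n hn
    simp [invQPoch, not_lt.mpr hn]
  have hcoef (j : ℤ) : Tendsto (fun n => centralQBinom (r ^ 2) n j) atTop (𝓝 d⁻¹) := by
    have e1 := ht.comp (tendsto_id.const_mul_atTop' (two_pos : 0 < 2))
    have e2 := hlim (fun n => n + j) (tendsto_natCast_atTop_atTop.atTop_add tendsto_const_nhds)
    have e3 := hlim (fun n => n - j)
      (tendsto_natCast_atTop_atTop.atTop_add (tendsto_const_nhds (x := -j)))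
    have e := (e1.mul e2).mul e3
    rw [mul_inv_cancel₀ hd.ne', one_mul] at e
    exact e
  have hbd (n : ℕ) (j : ℤ) : |centralQBinom (r ^ 2) n j| ≤ d⁻¹ * d⁻¹ := by
    have hp := (qPoch_pos hQ0 hQ1 (2 * n)).le
    rw [centralQBinom, abs_of_nonneg (mul_nonneg (mul_nonneg hp (hip0 _)) (hip0 _))]
    refine mul_le_mul ?_ (hip1 _) (hip0 _) (inv_pos.mpr hd).le
    exact (mul_le_of_le_one_left (hip0 _) (qPoch_le_one hQ0 hQ1 _)).trans (hip1 _)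
  have hdom := tendsto_tsum_of_dominated_convergence (𝓕 := atTop)
    (f := fun n (j : ℤ) => ((centralQBinom (r ^ 2) n j * r ^ (j ^ 2) : ℝ) : ℂ) * z ^ j)
    (g := fun j : ℤ => ((d⁻¹ * r ^ (j ^ 2) : ℝ) : ℂ) * z ^ j)
    (bound := fun j : ℤ => d⁻¹ * d⁻¹ * ‖((r ^ (j ^ 2) : ℝ) : ℂ) * z ^ j‖)
    (hth.summable.norm.mul_left _)
    (fun j => (((Complex.continuous_ofReal.tendsto _).comp
      ((hcoef j).mul_const (r ^ (j ^ 2)))).mul_const _))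
    (Eventually.of_forall fun n j => by
      rw [Complex.ofReal_mul, mul_assoc, norm_mul, Complex.norm_real, Real.norm_eq_abs]
      exact mul_le_mul_of_nonneg_right (hbd n j) (norm_nonneg _))
  simp only [(hasSum_finite_triple_product h0 h1 (Complex.exp_ne_zero _) _).tsum_eq, hz,
    ← prod_thetaFactor_eq] at hdom
  simp only [← hz] at hdom
  have hg : HasSum (fun j : ℤ => ((d⁻¹ * r ^ (j ^ 2) : ℝ) : ℂ) * z ^ j)
      (((d⁻¹ : ℝ) : ℂ) * theta3 ((t / 2 : ℝ) : ℂ) r) := by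
    simpa [mul_assoc] using hth.mul_left ((d⁻¹ : ℝ) : ℂ)
  rw [hg.tsum_eq] at hdom
  have := hdom.const_mul ((d : ℝ) : ℂ)
  rw [← mul_assoc, ← Complex.ofReal_mul, mul_inv_cancel₀ hd.ne', Complex.ofReal_one,
    one_mul] at this
  simpa using this

/-! ### Positivity and monotone ratios -/

/-- The real function `t ↦ ϑ₃(t / 2, r)`. -/
noncomputable def thetaHalf (r t : ℝ) : ℝ := (theta3 ((t / 2 : ℝ) : ℂ) r).re

section thetaHalf

variable {r : ℝ}

theorem exists_thetaHalf_product (h0 : 0 < r) (h1 : r < 1) :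
    ∃ d > 0, ∀ t : ℝ, Tendsto (fun n => d * ∏ k ∈ range n, thetaFactor r (Real.cos t) k) atTop
      (𝓝 (thetaHalf r t)) := by
  obtain ⟨d, hd, h⟩ := exists_theta3_product h0 h1
  exact ⟨d, hd, fun t => (Complex.continuous_re.tendsto _).comp (h t)⟩

theorem ofReal_thetaHalf (h0 : 0 < r) (h1 : r < 1) (t : ℝ) :
    (thetaHalf r t : ℂ) = theta3 ((t / 2 : ℝ) : ℂ) r := by
  obtain ⟨d, hd, h⟩ := exists_theta3_product h0 h1
  have him := (Complex.continuous_im.tendsto _).comp (h t)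
  have h2 : (theta3 ((t / 2 : ℝ) : ℂ) r).im = 0 :=
    tendsto_nhds_unique him (tendsto_const_nhds.congr fun n => (Complex.ofReal_im _).symm)
  apply Complex.ext
  · rfl
  · rw [h2, Complex.ofReal_im]

theorem thetaHalf_congr (h0 : 0 < r) (h1 : r < 1) {s t : ℝ} (h : Real.cos s = Real.cos t) :
    thetaHalf r s = thetaHalf r t := by
  obtain ⟨d, hd, hp⟩ := exists_thetaHalf_product h0 h1
  exact tendsto_nhds_unique (hp s) (by simpa only [h] using hp t)

theorem pow_odd_lt_one (h0 : 0 < r) (h1 : r < 1) (k : ℕ) : r ^ (2 * k + 1) < 1 :=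
  pow_lt_one₀ h0.le h1 (by omega)

theorem sq_le_thetaFactor (h0 : 0 < r) {c : ℝ} (hc : -1 ≤ c) (k : ℕ) :
    (1 - r ^ (2 * k + 1)) ^ 2 ≤ thetaFactor r c k := by
  have := pow_pos h0 (2 * k + 1)
  unfold thetaFactor
  nlinarith

theorem thetaFactor_pos (h0 : 0 < r) (h1 : r < 1) {c : ℝ} (hc : -1 ≤ c) (k : ℕ) :
    0 < thetaFactor r c k :=
  (pow_pos (sub_pos.mpr (pow_odd_lt_one h0 h1 k)) 2).trans_le (sq_le_thetaFactor h0 hc k)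

/-- The partial products are at least `∏ (1 - r ^ (2k+1)) ^ 2`, which stays away from zero. -/
theorem thetaHalf_pos (h0 : 0 < r) (h1 : r < 1) (t : ℝ) : 0 < thetaHalf r t := by
  obtain ⟨d, hd, hp⟩ := exists_thetaHalf_product h0 h1
  have hs : Summable fun k : ℕ => r ^ (2 * k + 1) :=
    (summable_geometric_of_lt_one h0.le h1).comp_injective
      (i := fun k : ℕ => 2 * k + 1) fun a b h => by simpa using h
  obtain ⟨e, he, hl⟩ := exists_pos_tendsto_prod_one_sub (pow_odd_lt_one h0 h1) hs
  refine lt_of_lt_of_le (mul_pos hd (pow_pos he 2))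
    (le_of_tendsto_of_tendsto' ((hl.pow 2).const_mul d) (hp t) fun n => ?_)
  rw [← prod_pow]
  exact mul_le_mul_of_nonneg_left (prod_le_prod (fun k _ => sq_nonneg _)
    fun k _ => sq_le_thetaFactor h0 (Real.neg_one_le_cos t) k) hd.le

theorem thetaFactor_mul_sub (c c' : ℝ) (k : ℕ) :
    thetaFactor r c k * thetaFactor r (-c') k - thetaFactor r (-c) k * thetaFactor r c' k =
      4 * r ^ (2 * k + 1) * (1 + (r ^ (2 * k + 1)) ^ 2) * (c - c') := by
  unfold thetaFactor
  ring

/-- The ratio `ϑ₃(t / 2 + π / 2, r) / ϑ₃(t / 2, r)` is strictly increasing on `[0, π]`, stated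
without division. Every factor of the triple product of the ratio is monotone in `cos t`. The
first factor is kept apart, so that the strict inequality survives the limit. -/
theorem thetaHalf_cross_lt (h0 : 0 < r) (h1 : r < 1) {s t : ℝ} (hs : 0 ≤ s) (hst : s < t)
    (ht : t ≤ Real.pi) :
    thetaHalf r (s + Real.pi) * thetaHalf r t < thetaHalf r s * thetaHalf r (t + Real.pi) := by
  obtain ⟨d, hd, hp⟩ := exists_thetaHalf_product h0 h1
  have hc : Real.cos t < Real.cos s := Real.cos_lt_cos_of_nonneg_of_le_pi hs ht hst
  have hs1 := hp (s + Real.pi)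
  have ht1 := hp (t + Real.pi)
  rw [Real.cos_add_pi] at hs1 ht1
  have b1 := Real.neg_one_le_cos s
  have b2 := Real.cos_le_one s
  have b3 := Real.neg_one_le_cos t
  have b4 := Real.cos_le_one t
  set c := Real.cos s
  set c' := Real.cos t
  set X : ℕ → ℝ := fun k => thetaFactor r (-c) k * thetaFactor r c' k
  set Y : ℕ → ℝ := fun k => thetaFactor r c k * thetaFactor r (-c') k
  have hX : ∀ k, 0 < X k := fun k =>
    mul_pos (thetaFactor_pos h0 h1 (by linarith) k) (thetaFactor_pos h0 h1 b3 k)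
  have hY : ∀ k, 0 < Y k := fun k =>
    mul_pos (thetaFactor_pos h0 h1 b1 k) (thetaFactor_pos h0 h1 (by linarith) k)
  have hXY : ∀ k, X k < Y k := fun k => by
    have h := thetaFactor_mul_sub (r := r) c c' k
    have h3 : 0 < 4 * r ^ (2 * k + 1) * (1 + (r ^ (2 * k + 1)) ^ 2) * (c - c') :=
      mul_pos (by positivity) (sub_pos.mpr hc)
    exact sub_pos.mp (h3.trans_eq h.symm)
  have hA : 0 < thetaHalf r s * thetaHalf r (t + Real.pi) :=
    mul_pos (thetaHalf_pos h0 h1 _) (thetaHalf_pos h0 h1 _)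
  have key : thetaHalf r (s + Real.pi) * thetaHalf r t ≤
      X 0 / Y 0 * (thetaHalf r s * thetaHalf r (t + Real.pi)) := by
    refine le_of_tendsto_of_tendsto (hs1.mul (hp t)) (((hp s).mul ht1).const_mul _) ?_
    filter_upwards [eventually_ge_atTop 1] with n hn
    obtain ⟨m, rfl⟩ : ∃ m, n = m + 1 := ⟨n - 1, by omega⟩
    have e1 : ∏ k ∈ range m, X (k + 1) ≤ ∏ k ∈ range m, Y (k + 1) :=
      prod_le_prod (fun k _ => (hX _).le) fun k _ => (hXY _).le
    have e2 : ∀ f g : ℕ → ℝ, (d * ∏ k ∈ range (m + 1), f k) * (d * ∏ k ∈ range (m + 1), g k) =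
        d ^ 2 * ((∏ k ∈ range m, f (k + 1) * g (k + 1)) * (f 0 * g 0)) := fun f g => by
      rw [← prod_range_succ' (fun k => f k * g k), prod_mul_distrib]; ring
    rw [e2, e2]
    calc d ^ 2 * ((∏ k ∈ range m, X (k + 1)) * X 0)
        ≤ d ^ 2 * ((∏ k ∈ range m, Y (k + 1)) * X 0) := by
          have := (hX 0).le
          gcongr
      _ = X 0 / Y 0 * (d ^ 2 * ((∏ k ∈ range m, Y (k + 1)) * Y 0)) := by
          have := (hY 0).ne'
          field_simp
  refine key.trans_lt (mul_lt_of_lt_one_left hA ?_)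
  rw [div_lt_one (hY 0)]
  exact hXY 0

end thetaHalf

/-! ### Doubling the nome -/

theorem hasSum_theta3_half {r : ℝ} (h0 : 0 < r) (h1 : r < 1) (t : ℝ) :
    HasSum (fun k : ℤ => (r : ℂ) ^ (k ^ 2) * Complex.exp (t * Complex.I) ^ k)
      (theta3 ((t / 2 : ℝ) : ℂ) r) := by
  have h := hasSum_theta3 ((t / 2 : ℝ) : ℂ) (r : ℂ) (by
    rwa [Complex.norm_real, Real.norm_of_nonneg h0.le])
  simp only [theta3_half_term] at h
  exact_mod_cast h

theorem exp_add_pi_mul_I (t : ℝ) :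
    Complex.exp (((t + Real.pi : ℝ) : ℂ) * Complex.I) = -Complex.exp (t * Complex.I) := by
  push_cast
  rw [add_mul, Complex.exp_add, Complex.exp_pi_mul_I, mul_neg_one]

theorem exp_two_mul_I_mul (k : ℤ) (t : ℂ) :
    Complex.exp (2 * Complex.I * (k : ℂ) * t) = Complex.exp (t * Complex.I) ^ (2 * k) := by
  rw [← Complex.exp_int_mul]
  push_cast
  congr 1
  ring

/-- Shifting `t / 2` by `π / 2` changes the sign of the odd terms of the series, so the even terms
are left, and they form a theta series with nome `r ^ 4`. -/
theorem theta3_half_add_shift {r : ℝ} (h0 : 0 < r) (h1 : r < 1) (t : ℝ) :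
    theta3 ((t / 2 : ℝ) : ℂ) r + theta3 (((t + Real.pi) / 2 : ℝ) : ℂ) r =
      2 * theta3 t ((r : ℂ) ^ 4) := by
  have hA := hasSum_theta3_half h0 h1 t
  have hB := hasSum_theta3_half h0 h1 (t + Real.pi)
  rw [exp_add_pi_mul_I] at hB
  set z := Complex.exp (t * Complex.I) with hz
  have hq : ‖(r : ℂ) ^ 4‖ < 1 := by
    rw [norm_pow, Complex.norm_real, Real.norm_of_nonneg h0.le]
    exact pow_lt_one₀ h0.le h1 (by norm_num)
  have hinj : Function.Injective fun j : ℤ => 2 * j := fun a b h => by simpa using h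
  refine (hA.add hB).unique ((hinj.hasSum_iff fun k hk => ?_).mp
    (((hasSum_theta3 t _ hq).mul_left 2).congr_fun fun j => ?_))
  · have hodd : Odd k := by
      rw [← Int.not_even_iff_odd]
      rintro ⟨j, rfl⟩
      exact hk ⟨j, two_mul j⟩
    rw [hodd.neg_zpow]
    ring
  · simp only [Function.comp]
    rw [(even_two_mul j).neg_zpow, exp_two_mul_I_mul, ← hz, ← zpow_natCast (r : ℂ) 4, ← zpow_mul,
      show (2 * j) ^ 2 = ((4 : ℕ) : ℤ) * j ^ 2 by push_cast; ring]
    ring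

theorem hasSum_mul_prod {f g : ℤ → ℂ} {a b : ℂ} (hf : HasSum f a) (hg : HasSum g b) :
    HasSum (fun p : ℤ × ℤ => f p.1 * g p.2) (a * b) :=
  hf.mul hg (summable_mul_of_summable_norm hf.summable.norm hg.summable.norm)

/-- In the double series for the two squares, the terms with `m + n` odd cancel; the substitution
`(m, n) = (a + b, a - b)` factors the remaining ones. -/
theorem theta3_half_sq_add_sq {r : ℝ} (h0 : 0 < r) (h1 : r < 1) (t : ℝ) :
    theta3 ((t / 2 : ℝ) : ℂ) r ^ 2 + theta3 (((t + Real.pi) / 2 : ℝ) : ℂ) r ^ 2 =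
      2 * (theta3 t ((r : ℂ) ^ 2) * theta3 0 ((r : ℂ) ^ 2)) := by
  have hA := hasSum_theta3_half h0 h1 t
  have hB := hasSum_theta3_half h0 h1 (t + Real.pi)
  rw [exp_add_pi_mul_I] at hB
  set z := Complex.exp (t * Complex.I) with hz
  have hz0 : z ≠ 0 := Complex.exp_ne_zero _
  have hr : (r : ℂ) ≠ 0 := Complex.ofReal_ne_zero.mpr h0.ne'
  have hq : ‖(r : ℂ) ^ 2‖ < 1 := by
    rw [norm_pow, Complex.norm_real, Real.norm_of_nonneg h0.le]
    exact pow_lt_one₀ h0.le h1 two_ne_zero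
  have hAA := hasSum_mul_prod hA hA
  have hBB := hasSum_mul_prod hB hB
  have hT := hasSum_theta3 t _ hq
  have hT0 := hasSum_theta3 0 _ hq
  have hTT := hasSum_mul_prod hT hT0
  have hinj : Function.Injective fun p : ℤ × ℤ => (p.1 + p.2, p.1 - p.2) := by
    rintro ⟨a, b⟩ ⟨c, d⟩ h
    simp only [Prod.mk.injEq] at h ⊢
    omega
  have hcomp := (hinj.hasSum_iff (f := fun p : ℤ × ℤ =>
      (r : ℂ) ^ (p.1 ^ 2) * z ^ p.1 * ((r : ℂ) ^ (p.2 ^ 2) * z ^ p.2) +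
      (r : ℂ) ^ (p.1 ^ 2) * (-z) ^ p.1 * ((r : ℂ) ^ (p.2 ^ 2) * (-z) ^ p.2))
    (a := 2 * (theta3 t ((r : ℂ) ^ 2) * theta3 0 ((r : ℂ) ^ 2))) ?_).mp
    ((hTT.mul_left 2).congr_fun ?_)
  · rw [sq, sq]
    exact (hAA.add hBB).unique hcomp
  · rintro ⟨m, n⟩ hmn
    dsimp only
    have hodd : Odd (m + n) := by
      rw [← Int.not_even_iff_odd]
      rintro ⟨a, ha⟩
      exact hmn ⟨(a, m - a), Prod.ext (by simp) (by simp; omega)⟩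
    have e1 : (-z) ^ m * (-z) ^ n = -(z ^ m * z ^ n) := by
      rw [← zpow_add₀ (neg_ne_zero.mpr hz0), hodd.neg_zpow, zpow_add₀ hz0]
    linear_combination (r : ℂ) ^ (m ^ 2) * (r : ℂ) ^ (n ^ 2) * e1
  · rintro ⟨a, b⟩
    have e1 : (-z) ^ (a + b) * (-z) ^ (a - b) = z ^ (2 * a) := by
      rw [← zpow_add₀ (neg_ne_zero.mpr hz0), show a + b + (a - b) = 2 * a by ring,
        (even_two_mul a).neg_zpow]
    have e2 : z ^ (a + b) * z ^ (a - b) = z ^ (2 * a) := by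
      rw [← zpow_add₀ hz0, show a + b + (a - b) = 2 * a by ring]
    have e3 : (r : ℂ) ^ ((a + b) ^ 2) * (r : ℂ) ^ ((a - b) ^ 2) =
        ((r : ℂ) ^ 2) ^ (a ^ 2) * ((r : ℂ) ^ 2) ^ (b ^ 2) := by
      rw [← zpow_add₀ hr, ← zpow_natCast (r : ℂ) 2, ← zpow_mul, ← zpow_mul, ← zpow_add₀ hr]
      congr 1
      push_cast
      ring
    simp only [Function.comp, exp_two_mul_I_mul, ← hz, zero_mul, Complex.exp_zero, one_zpow,
      mul_one]
    linear_combination (2 * z ^ (2 * a)) * e3 +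
      (r : ℂ) ^ ((a + b) ^ 2) * (r : ℂ) ^ ((a - b) ^ 2) * (e1 + e2)

/-! ### The ratio as a function of the contrast -/

/-- The normalized difference of `ϑ₃(t / 2, r)` and its shift by half a period. -/
noncomputable def thetaContrast (r t : ℝ) : ℝ :=
  (thetaHalf r t - thetaHalf r (t + Real.pi)) / (thetaHalf r t + thetaHalf r (t + Real.pi))

section thetaContrast

variable {r : ℝ}

theorem thetaContrast_strictAntiOn (h0 : 0 < r) (h1 : r < 1) :
    StrictAntiOn (thetaContrast r) (Set.Icc 0 Real.pi) := by
  intro s hs t ht hst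
  have h := thetaHalf_cross_lt h0 h1 hs.1 hst ht.2
  have p := thetaHalf_pos h0 h1
  unfold thetaContrast
  rw [div_lt_div_iff₀ (add_pos (p _) (p _)) (add_pos (p _) (p _))]
  linarith

theorem thetaContrast_pi_div_two (h0 : 0 < r) (h1 : r < 1) :
    thetaContrast r (Real.pi / 2) = 0 := by
  rw [thetaContrast, thetaHalf_congr h0 h1 (s := Real.pi / 2) (t := Real.pi / 2 + Real.pi)
    (by rw [Real.cos_add_pi, Real.cos_pi_div_two, neg_zero]), sub_self, zero_div]

theorem theta3_sq_ne_zero (h0 : 0 < r) (h1 : r < 1) (t : ℝ) :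
    theta3 t ((r : ℂ) ^ 4) ≠ 0 := by
  intro h
  have := theta3_half_add_shift h0 h1 t
  rw [h, mul_zero, ← ofReal_thetaHalf h0 h1, ← ofReal_thetaHalf h0 h1] at this
  have h2 : thetaHalf r t + thetaHalf r (t + Real.pi) = 0 := by exact_mod_cast this
  linarith [thetaHalf_pos h0 h1 t, thetaHalf_pos h0 h1 (t + Real.pi)]

theorem thetaRatio_eq (h0 : 0 < r) (h1 : r < 1) (t : ℝ) :
    thetaRatio ((r : ℂ) ^ 2) t =
      (((1 + thetaContrast r t ^ 2) / thetaHalf (r ^ 2) 0 : ℝ) : ℂ) := by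
  have hq0 : 0 < r ^ 2 := by positivity
  have hq1 : r ^ 2 < 1 := pow_lt_one₀ h0.le h1 two_ne_zero
  have e1 := theta3_half_add_shift h0 h1 t
  have e2 := theta3_half_sq_add_sq h0 h1 t
  have hT := ofReal_thetaHalf hq0 hq1 0
  rw [zero_div, Complex.ofReal_zero, Complex.ofReal_pow] at hT
  rw [← ofReal_thetaHalf h0 h1, ← ofReal_thetaHalf h0 h1] at e1 e2
  rw [← hT] at e2
  have hT0 : (thetaHalf (r ^ 2) 0 : ℂ) ≠ 0 := by exact_mod_cast (thetaHalf_pos hq0 hq1 0).ne'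
  have hS : ((thetaHalf r t : ℂ) + thetaHalf r (t + Real.pi)) ≠ 0 := by
    exact_mod_cast (add_pos (thetaHalf_pos h0 h1 t) (thetaHalf_pos h0 h1 (t + Real.pi))).ne'
  have e3 : theta3 t ((r : ℂ) ^ 2) = ((thetaHalf r t : ℂ) ^ 2 +
      (thetaHalf r (t + Real.pi) : ℂ) ^ 2) / (2 * thetaHalf (r ^ 2) 0) := by
    rw [eq_div_iff (mul_ne_zero two_ne_zero hT0), e2]
    ring
  have e4 : theta3 t ((r : ℂ) ^ 4) =
      ((thetaHalf r t : ℂ) + thetaHalf r (t + Real.pi)) / 2 := by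
    rw [eq_div_iff two_ne_zero, e1]
    ring
  rw [thetaRatio, ← pow_mul, e3, e4, thetaContrast]
  push_cast
  field_simp
  ring

end thetaContrast

/-! ### Monotonicity of the ratio -/

theorem theorem5 (σ : ℝ) (hσ : 0 < σ) (q : ℝ) (hq : q = Real.exp (-1 / (4 * σ ^ 2))) :
    (∀ t ∈ Set.Icc (0 : ℝ) Real.pi,
      theta3 (t : ℂ) ((q : ℂ) ^ 2) ≠ 0 ∧ (thetaRatio (q : ℂ) (t : ℂ)).im = 0) ∧
    StrictAntiOn (fun t : ℝ => (thetaRatio (q : ℂ) (t : ℂ)).re) (Set.Ioo 0 (Real.pi / 2)) ∧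
    StrictMonoOn (fun t : ℝ => (thetaRatio (q : ℂ) (t : ℂ)).re)
      (Set.Ioo (Real.pi / 2) Real.pi) := by
  have hq0 : 0 < q := hq ▸ Real.exp_pos _
  have hq1 : q < 1 := by
    rw [hq, Real.exp_lt_one_iff]
    exact div_neg_of_neg_of_pos (by norm_num) (by positivity)
  -- The two identities for `A` and `B` need the square root of the nome.
  obtain ⟨r, h0, h1, rfl⟩ : ∃ r : ℝ, 0 < r ∧ r < 1 ∧ q = r ^ 2 :=
    ⟨√q, Real.sqrt_pos.mpr hq0, by rwa [Real.sqrt_lt' one_pos, one_pow], (Real.sq_sqrt hq0.le).symm⟩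
  have hT := thetaHalf_pos hq0 hq1 0
  have hanti := thetaContrast_strictAntiOn h0 h1
  have hmid := thetaContrast_pi_div_two h0 h1
  have hpi := Real.pi_pos
  have hm : Real.pi / 2 ∈ Set.Icc 0 Real.pi := ⟨by linarith, by linarith⟩
  simp only [Complex.ofReal_pow, thetaRatio_eq h0 h1, Complex.ofReal_re, Complex.ofReal_im,
    and_true]
  refine ⟨fun t _ => ?_, fun s hs t ht hst => ?_, fun s hs t ht hst => ?_⟩
  · rw [← pow_mul]
    exact theta3_sq_ne_zero h0 h1 t
  · have k1 := hanti ⟨hs.1.le, by linarith [hs.2]⟩ ⟨ht.1.le, by linarith [ht.2]⟩ hst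
    have k2 := hanti ⟨ht.1.le, by linarith [ht.2]⟩ hm ht.2
    rw [hmid] at k2
    exact div_lt_div_of_pos_right (by nlinarith) hT
  · have k1 := hanti ⟨by linarith [hs.1], hs.2.le⟩ ⟨by linarith [ht.1], ht.2.le⟩ hst
    have k2 := hanti hm ⟨by linarith [hs.1], hs.2.le⟩ hs.1
    rw [hmid] at k2
    exact div_lt_div_of_pos_right (by nlinarith) hT
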